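/- Let $n$ be a natural number and let $\varphi_1,\varphi_2\in L^2(\mathbb R^{2n})$. For $k,l\in\mathbb Z^n$ let \[T^t_{(k,l)}\varphi(x,y)=e^{\pi i(x\cdot l-y\cdot k)}\,\varphi(x-k,y-l),\qquad (x,y)\in\mathbb R^n\times\mathbb R^n,\] be the twisted translation on $L^2(\mathbb R^{2n})$, and let $V^t(\varphi)=\overline{\operatorname{span}}\{T^t_{(k,l)}\varphi:k,l\in\mathbb Z^n\}\subset L^2(\mathbb R^{2n})$ be the principal twisted shift-invariant space generated by $\varphi$. For $g\in L^1\cap L^2(\mathbb R^{2n})$ let \[K_g(\xi,\eta)=\int_{\mathbb R^n}g(x,\eta-\xi)\,e^{\pi i x\cdot(\xi+\eta)}\,dx\] be the kernel of the Weyl transform of $g$, and extend the isometry $g\mapsto K_g$ by continuity to all of $L^2(\mathbb R^{2n})$. Identify $\mathbb T^n$ with $[0,1)^n$, equipped with Lebesgue measure. The Weyl--Zak transform of $\varphi\in L^2(\mathbb R^{2n})$ is \[Z_W\varphi(\xi,\xi',\eta)=\sum_{m\in\mathbb Z^n}K_\varphi(m+\xi,\eta)\,e^{-2\pi i m\cdot\xi'},\qquad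 \xi,\xi'\in\mathbb T^n,\ \eta\in\mathbb R^n,\] the series converging in $L^2(\mathbb T^n\times\mathbb T^n\times\mathbb R^n)$, and $\mathcal J\varphi(\xi,\xi')\in L^2(\mathbb R^n)$ is defined, for a.e. $(\xi,\xi')\in\mathbb T^n\times\mathbb T^n$, by $\mathcal J\varphi(\xi,\xi')(\eta)=Z_W\varphi(\xi,\xi',\eta)$. Then the spaces $V^t(\varphi_1)$ and $V^t(\varphi_2)$ are orthogonal in $L^2(\mathbb R^{2n})$ if and only if \[\langle\mathcal J\varphi_1(\xi,\xi'),\mathcal J\varphi_2(\xi,\xi')\rangle_{L^2(\mathbb R^n)}=0\qquad\text{for a.e. }(\xi,\xi')\in\mathbb T^n\times\mathbb T^n.\] -/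

import Mathlib

open MeasureTheory

noncomputable section

/-- `ℝⁿ` with its Euclidean structure and Lebesgue measure. -/
abbrev RSpace (n : ℕ) : Type := EuclideanSpace ℝ (Fin n)

/-- `L²(ℝⁿ)`. -/
abbrev L2R (n : ℕ) : Type := Lp (α := RSpace n) ℂ 2 volume

/-- `L²(ℝ²ⁿ)`, with `ℝ²ⁿ` written as `ℝⁿ × ℝⁿ`, points `(x, y)`. -/
abbrev L2R2 (n : ℕ) : Type := Lp (α := RSpace n × RSpace n) ℂ 2 volume

/-- An integer vector, seen in `ℝⁿ`. -/
def intVec {n : ℕ} (k : Fin n → ℤ) : RSpace n := WithLp.toLp 2 fun i => (k i : ℝ)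

/-! ### Twisted translations and principal twisted shift-invariant spaces -/

/-- The twisted translate of a function,
`(x, y) ↦ e^{π i (x·l - y·k)} φ(x - k, y - l)`. -/
def twistedTranslateFun {n : ℕ} (k l : Fin n → ℤ) (φ : RSpace n × RSpace n → ℂ)
    (p : RSpace n × RSpace n) : ℂ :=
  Complex.exp (Real.pi * Complex.I *
      ((inner ℝ p.1 (intVec l) - inner ℝ p.2 (intVec k) : ℝ) : ℂ)) *
    φ (p.1 - intVec k, p.2 - intVec l)

theorem memLp_twistedTranslateFun {n : ℕ} (k l : Fin n → ℤ) (φ : L2R2 n) :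
    MemLp (twistedTranslateFun k l φ) 2 volume := by
  have h1 : MeasurePreserving
      (fun p : RSpace n × RSpace n => (p.1 - intVec k, p.2 - intVec l)) volume volume := by
    exact (measurePreserving_sub_right (volume : Measure (RSpace n)) (intVec k)).prod
      (measurePreserving_sub_right (volume : Measure (RSpace n)) (intVec l))
  have h2 := (Lp.memLp φ).comp_measurePreserving h1
  have h3 : Continuous fun p : RSpace n × RSpace n => Complex.exp (Real.pi * Complex.I *
      ((inner ℝ p.1 (intVec l) - inner ℝ p.2 (intVec k) : ℝ) : ℂ)) := by
    fun_prop
  refine h2.of_le (h3.aestronglyMeasurable.mul h2.1) (Filter.Eventually.of_forall fun p => ?_)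
  unfold twistedTranslateFun
  rw [norm_mul, Complex.norm_exp]
  simp

/-- The twisted translation operator `T^t_{(k,l)}` on `L²(ℝ²ⁿ)`. -/
def twistedTranslate {n : ℕ} (k l : Fin n → ℤ) (φ : L2R2 n) : L2R2 n :=
  (memLp_twistedTranslateFun k l φ).toLp

/-- The principal twisted shift-invariant space `V^t(φ)`: the closed linear span of all
twisted translates `T^t_{(k,l)} φ`, `k, l ∈ ℤⁿ`. -/
def principalSpace {n : ℕ} (φ : L2R2 n) : Submodule ℂ (L2R2 n) :=
  (Submodule.span ℂ
    (Set.range fun p : (Fin n → ℤ) × (Fin n → ℤ) =>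
      twistedTranslate p.1 p.2 φ)).topologicalClosure

/-! ### The kernel of the Weyl transform -/

/-- The integral formula for the kernel of the Weyl transform,
`K_g(ξ, η) = ∫ g(x, η - ξ) e^{π i x·(ξ + η)} dx`. -/
def weylKernelFun {n : ℕ} (g : RSpace n × RSpace n → ℂ) (p : RSpace n × RSpace n) : ℂ :=
  ∫ x : RSpace n, g (x, p.2 - p.1) *
    Complex.exp (Real.pi * Complex.I * ((inner ℝ x (p.1 + p.2) : ℝ) : ℂ))

open Classical in
/-- The map `g ↦ K_g` given by the integral formula. It is used only for `g ∈ L¹ ∩ L²`, where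
`K_g ∈ L²(ℝ²ⁿ)`, so that the first branch applies. -/
def weylKernelL1 {n : ℕ} (g : L2R2 n) : L2R2 n :=
  if h : MemLp (weylKernelFun g) 2 (volume : Measure (RSpace n × RSpace n)) then h.toLp else 0

/-- The kernel `K_φ` of the Weyl transform of `φ ∈ L²(ℝ²ⁿ)`: the extension by continuity to
`L²(ℝ²ⁿ)` of the (isometric) map `g ↦ K_g` on its dense subspace `L¹ ∩ L²`. -/
def weylKernel {n : ℕ} (φ : L2R2 n) : L2R2 n :=
  extendFrom {g : L2R2 n | Integrable (g : RSpace n × RSpace n → ℂ) volume} weylKernelL1 φ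

/-! ### The Weyl-Zak transform and the map `𝒥` -/

/-- `𝕋ⁿ`, as the fundamental domain `[0,1)ⁿ` of `ℝⁿ / ℤⁿ`. -/
def torusCube (n : ℕ) : Set (RSpace n) := {ξ | ∀ i, ξ i ∈ Set.Ico (0 : ℝ) 1}

/-- The measure of `𝕋ⁿ`: Lebesgue measure on `[0,1)ⁿ`. -/
def torusMeasure (n : ℕ) : Measure (RSpace n) := volume.restrict (torusCube n)

theorem torusMeasure_univ (n : ℕ) : torusMeasure n Set.univ = 1 := by
  have h := (EuclideanSpace.volume_preserving_symm_measurableEquiv_toLp (Fin n))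
  have h2 : torusCube n = (MeasurableEquiv.toLp 2 (Fin n → ℝ)).symm ⁻¹'
      (Set.univ.pi fun _ => Set.Ico (0 : ℝ) 1) := by
    ext ξ; simp [torusCube]
  rw [torusMeasure, Measure.restrict_apply_univ, h2, h.measure_preimage_equiv, volume_pi_pi]
  simp

instance instIsProbabilityMeasureTorusMeasure (n : ℕ) : IsProbabilityMeasure (torusMeasure n) :=
  ⟨torusMeasure_univ n⟩

/-- The measure of `𝕋ⁿ × 𝕋ⁿ × ℝⁿ`, whose points are written `((ξ, ξ'), η)`. -/
abbrev zakMeasure (n : ℕ) : Measure ((RSpace n × RSpace n) × RSpace n) :=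
  ((torusMeasure n).prod (torusMeasure n)).prod volume

/-- `L²(𝕋ⁿ × 𝕋ⁿ × ℝⁿ)`. -/
abbrev L2Zak (n : ℕ) : Type := Lp ℂ 2 (zakMeasure n)

/-- The `m`-th term `((ξ, ξ'), η) ↦ K(m + ξ, η) e^{-2π i m·ξ'}` of the Zak series. -/
def zakTermFun {n : ℕ} (m : Fin n → ℤ) (K : RSpace n × RSpace n → ℂ)
    (p : (RSpace n × RSpace n) × RSpace n) : ℂ :=
  K (intVec m + p.1.1, p.2) *
    Complex.exp (-(2 * Real.pi * Complex.I * ((inner ℝ (intVec m) p.1.2 : ℝ) : ℂ)))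

theorem memLp_zakTermFun {n : ℕ} (m : Fin n → ℤ) (K : L2R2 n) :
    MemLp (zakTermFun m K) 2 (zakMeasure n) := by
  have h1 : MeasurePreserving
      (fun p : RSpace n × RSpace n => (intVec m + p.1, p.2)) volume volume :=
    (measurePreserving_add_left (volume : Measure (RSpace n)) (intVec m)).prod
      (MeasurePreserving.id volume)
  have h2 := (Lp.memLp K).comp_measurePreserving h1
  have h3 : (torusMeasure n).prod (volume : Measure (RSpace n)) ≤
      (volume : Measure (RSpace n × RSpace n)) := by
    have : (torusMeasure n).prod (volume : Measure (RSpace n)) =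
        (volume : Measure (RSpace n × RSpace n)).restrict (torusCube n ×ˢ Set.univ) := by
      rw [Measure.volume_eq_prod, ← Measure.prod_restrict, Measure.restrict_univ, torusMeasure]
    rw [this]
    exact Measure.restrict_le_self
  have h4 := h2.mono_measure h3
  have h5 : MeasurePreserving
      (fun p : (RSpace n × RSpace n) × RSpace n => (p.1.1, p.2)) (zakMeasure n)
      ((torusMeasure n).prod volume) :=
    measurePreserving_fst.prod (MeasurePreserving.id volume)
  have h6 := h4.comp_measurePreserving h5
  have h7 : Continuous fun p : (RSpace n × RSpace n) × RSpace n =>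
      Complex.exp (-(2 * Real.pi * Complex.I * ((inner ℝ (intVec m) p.1.2 : ℝ) : ℂ))) := by
    fun_prop
  refine h6.of_le (h6.1.mul h7.aestronglyMeasurable) (Filter.Eventually.of_forall fun p => ?_)
  unfold zakTermFun
  rw [norm_mul, Complex.norm_exp]
  simp

/-- The `m`-th term of the Zak series of `K ∈ L²(ℝ²ⁿ)`, as an element of `L²(𝕋ⁿ × 𝕋ⁿ × ℝⁿ)`. -/
def zakTerm {n : ℕ} (m : Fin n → ℤ) (K : L2R2 n) : L2Zak n :=
  (memLp_zakTermFun m K).toLp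

/-- The Weyl-Zak transform
`Z_W φ (ξ, ξ', η) = ∑_{m ∈ ℤⁿ} K_φ(m + ξ, η) e^{-2π i m·ξ'}`. The terms are pairwise orthogonal
with square-summable norms, so the series converges unconditionally in `L²(𝕋ⁿ × 𝕋ⁿ × ℝⁿ)`. -/
def weylZak {n : ℕ} (φ : L2R2 n) : L2Zak n :=
  ∑' m : Fin n → ℤ, zakTerm m (weylKernel φ)

open Classical in
/-- The map `𝒥`: `𝒥 φ (ξ, ξ')` is the element `η ↦ Z_W φ (ξ, ξ', η)` of `L²(ℝⁿ)`, which is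
defined for almost every `(ξ, ξ')` (and set to `0` on the exceptional null set). -/
def jMap {n : ℕ} (φ : L2R2 n) (p : RSpace n × RSpace n) : L2R n :=
  if h : MemLp (fun η : RSpace n => weylZak φ (p, η)) 2 volume then h.toLp else 0

end

/-! The Weyl–Zak transform is an isometry that turns each twisted translation into multiplication by
a unimodular function of `(ξ, ξ')` alone, so orthogonality of the two spaces becomes a statement
about Fourier coefficients on `𝕋ⁿ × 𝕋ⁿ`.

Isometry (`inner_weylZak`): `K_g` is the inverse Fourier transform of `g` in its first variable,
composed with the measure-preserving map `(ξ, η) ↦ ((ξ + η)/2, η - ξ)`, so Plancherel gives `‖K_g‖ =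
‖g‖`. The Zak series cuts `ℝⁿ × ℝⁿ` into unit strips and attaches orthonormal characters in `ξ'` to
them, which preserves inner products.

Covariance (`weylZak_twistedTranslate`): `T^t_{(k,l)}` becomes multiplication by `e^{πi(k·l + 2k·ξ +
2l·ξ')}`. By Fubini, `inner_twistedTranslate` then writes the inner product of two twisted
translates as the integral of `h = ⟨𝒥φ₁, 𝒥φ₂⟩` against a character, up to a unimodular constant.

If `h = 0` a.e., all these inner products vanish. Conversely, orthogonality annihilates every
Fourier coefficient of the integrable function `h`, and uniqueness of Fourier coefficients
(`ae_eq_zero_of_forall_integral_exp`) gives `h = 0` a.e. -/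

noncomputable section

/-! ### Plancherel for the inverse Fourier integral on `L¹ ∩ L²` -/

open FourierTransform SchwartzMap ContDiff in
/-- On `L¹ ∩ L²` the inverse Fourier integral agrees with the `L²` inverse Fourier transform. -/
theorem fourierInv_ae_eq_fourierInv_toLp {E : Type*} [NormedAddCommGroup E]
    [InnerProductSpace ℝ E] [FiniteDimensional ℝ E] [MeasurableSpace E] [BorelSpace E]
    {f : E → ℂ} (hf : Integrable f) (hf2 : MemLp f 2) :
    ∀ᵐ x, 𝓕⁻ f x = (𝓕⁻ (hf2.toLp f) : Lp (α := E) ℂ 2 volume) x := by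
  have hcont : Continuous (𝓕⁻ f) := by
    have h : 𝓕⁻ f = fun w => 𝓕 f (-w) := by ext w; exact Real.fourierInv_eq_fourier_neg f w
    rw [h]
    exact (VectorFourier.fourierIntegral_continuous Real.continuous_fourierChar
      (by exact continuous_inner) hf).comp continuous_neg
  -- Both sides are locally integrable, so it suffices to compare them as distributions.
  refine ae_eq_of_integral_contDiff_smul_eq hcont.locallyIntegrable
    ((Lp.memLp _).locallyIntegrable (by norm_num)) fun g g_smooth g_cpt => ?_
  have hg₁ : HasCompactSupport (Complex.ofRealCLM ∘ g) := g_cpt.comp_left rfl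
  have hg₂ : ContDiff ℝ ∞ (Complex.ofRealCLM ∘ g) := by fun_prop
  set G : 𝓢(E, ℂ) := hg₁.toSchwartzMap hg₂ with hG
  have hGg : ∀ x, G x = (g x : ℂ) := fun x => rfl
  have h1 := Lp.fourierInv_toTemperedDistribution_eq (hf2.toLp f)
  have h2 := congrArg (fun T : 𝓢'(E, ℂ) => T G) h1
  simp only [TemperedDistribution.fourierInv_apply, Lp.toTemperedDistribution_apply] at h2
  have h3 : ∫ x, (𝓕⁻ G) x • (hf2.toLp f) x = ∫ x, (𝓕⁻ G) x • f x := by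
    refine integral_congr_ae ?_
    filter_upwards [hf2.coeFn_toLp] with x hx
    rw [hx]
  -- Fubini moves `𝓕⁻` from the test function to `f`; the pairing `-innerₗ E` encodes the sign of
  -- the inverse transform.
  have h4 : ∫ x, (𝓕⁻ G) x • f x = ∫ x, G x • 𝓕⁻ f x := by
    have h := VectorFourier.integral_fourierIntegral_smul_eq_flip (μ := (volume : Measure E))
      (ν := (volume : Measure E)) (L := -innerₗ E) (f := G) (g := f)
      Real.continuous_fourierChar
      ((continuous_inner (𝕜 := ℝ) (E := E)).neg.congr fun p => by simp) G.integrable hf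
    have e1 : ∀ w, VectorFourier.fourierIntegral Real.fourierChar volume (-innerₗ E) G w =
        (𝓕⁻ G) w := fun w => by
      rw [SchwartzMap.fourierInv_coe, Real.fourierInv_eq, VectorFourier.fourierIntegral]
      simp
    have e2 : ∀ w, VectorFourier.fourierIntegral Real.fourierChar volume (-innerₗ E).flip f w =
        𝓕⁻ f w := fun w => by
      rw [Real.fourierInv_eq, VectorFourier.fourierIntegral]
      simp [real_inner_comm]
    simpa only [e1, e2] using h
  calc ∫ x, g x • 𝓕⁻ f x = ∫ x, G x • 𝓕⁻ f x := by simp [hGg]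
    _ = ∫ x, G x • (𝓕⁻ (hf2.toLp f) : Lp (α := E) ℂ 2 volume) x := by rw [← h4, ← h3, h2]
    _ = _ := by simp [hGg]

open FourierTransform in
/-- Plancherel's theorem for the inverse Fourier integral on `L¹ ∩ L²`. -/
theorem lintegral_enorm_sq_fourierInv {E : Type*} [NormedAddCommGroup E]
    [InnerProductSpace ℝ E] [FiniteDimensional ℝ E] [MeasurableSpace E] [BorelSpace E]
    {f : E → ℂ} (hf : Integrable f) (hf2 : MemLp f 2) :
    ∫⁻ x, ‖𝓕⁻ f x‖ₑ ^ 2 = ∫⁻ x, ‖f x‖ₑ ^ 2 := by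
  have key : ∀ g : E → ℂ, ∫⁻ x, ‖g x‖ₑ ^ 2 = eLpNorm g 2 volume ^ 2 := fun g => by
    have := eLpNorm_nnreal_pow_eq_lintegral (f := g) (μ := (volume : Measure E)) (p := 2)
      (by norm_num)
    simpa using this.symm
  have h1 : eLpNorm (𝓕⁻ f) 2 volume =
      eLpNorm (𝓕⁻ (hf2.toLp f) : Lp (α := E) ℂ 2 volume) 2 volume :=
    eLpNorm_congr_ae (fourierInv_ae_eq_fourierInv_toLp hf hf2)
  have h2 : ‖(𝓕⁻ (hf2.toLp f) : Lp (α := E) ℂ 2 volume)‖ₑ = ‖hf2.toLp f‖ₑ :=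
    ((Lp.fourierTransformₗᵢ E ℂ).symm.enorm_map _)
  rw [Lp.enorm_def, Lp.enorm_toLp] at h2
  rw [key, key, h1, h2]

/-! ### Weighted composition operators on `L²` -/

section WeightedComp

variable {α β : Type*} [MeasurableSpace α] [MeasurableSpace β] {μ : Measure α} {ν : Measure β}

theorem MeasureTheory.MemLp.unimodular_mul {u f : α → ℂ} (hf : MemLp f 2 μ)
    (hu : AEStronglyMeasurable u μ) (hu1 : ∀ x, ‖u x‖ = 1) :
    MemLp (fun x => u x * f x) 2 μ :=
  hf.of_le (hu.mul hf.1) (Filter.Eventually.of_forall fun x => by simp [hu1])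

/-- The isometry `f ↦ u · (f ∘ θ)` of `L²`, for `θ` measure preserving and `u` unimodular. -/
def weightedComp (θ : α → β) (hθ : MeasurePreserving θ μ ν) (u : α → ℂ)
    (hu : AEStronglyMeasurable u μ) (hu1 : ∀ x, ‖u x‖ = 1) : Lp ℂ 2 ν →ₗᵢ[ℂ] Lp ℂ 2 μ where
  toFun f := (((Lp.memLp f).comp_measurePreserving hθ).unimodular_mul hu hu1).toLp
  map_add' f g := by
    ext1
    have h := hθ.quasiMeasurePreserving.ae (Lp.coeFn_add f g)
    filter_upwards [MemLp.coeFn_toLp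
        (((Lp.memLp (f + g)).comp_measurePreserving hθ).unimodular_mul hu hu1),
      MemLp.coeFn_toLp (((Lp.memLp f).comp_measurePreserving hθ).unimodular_mul hu hu1),
      MemLp.coeFn_toLp (((Lp.memLp g).comp_measurePreserving hθ).unimodular_mul hu hu1),
      Lp.coeFn_add (MemLp.toLp _ (((Lp.memLp f).comp_measurePreserving hθ).unimodular_mul hu hu1))
        (MemLp.toLp _ (((Lp.memLp g).comp_measurePreserving hθ).unimodular_mul hu hu1)), h]
      with x h1 h2 h3 h4 h5
    rw [h4, h1, Pi.add_apply, h2, h3]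
    simp only [Function.comp_apply, h5, Pi.add_apply]
    ring
  map_smul' c f := by
    ext1
    have h := hθ.quasiMeasurePreserving.ae (Lp.coeFn_smul c f)
    filter_upwards [MemLp.coeFn_toLp
        (((Lp.memLp (c • f)).comp_measurePreserving hθ).unimodular_mul hu hu1),
      MemLp.coeFn_toLp (((Lp.memLp f).comp_measurePreserving hθ).unimodular_mul hu hu1),
      Lp.coeFn_smul c
        (MemLp.toLp _ (((Lp.memLp f).comp_measurePreserving hθ).unimodular_mul hu hu1)), h]
      with x h1 h2 h4 h5
    rw [RingHom.id_apply, h4, h1, Pi.smul_apply, h2]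
    simp only [Function.comp_apply, h5, Pi.smul_apply, smul_eq_mul]
    ring
  norm_map' f := by
    rw [LinearMap.coe_mk, AddHom.coe_mk, Lp.norm_toLp, Lp.norm_def]
    congr 1
    rw [← eLpNorm_comp_measurePreserving (Lp.aestronglyMeasurable f) hθ]
    exact eLpNorm_congr_norm_ae (Filter.Eventually.of_forall fun x => by simp [hu1])

theorem coeFn_weightedComp (θ : α → β) (hθ : MeasurePreserving θ μ ν) (u : α → ℂ)
    (hu : AEStronglyMeasurable u μ) (hu1 : ∀ x, ‖u x‖ = 1) (f : Lp ℂ 2 ν) :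
    weightedComp θ hθ u hu hu1 f =ᵐ[μ] fun x => u x * f (θ x) :=
  MemLp.coeFn_toLp (((Lp.memLp f).comp_measurePreserving hθ).unimodular_mul hu hu1)

end WeightedComp

theorem norm_exp_pi_mul_I (r : ℝ) : ‖Complex.exp (Real.pi * Complex.I * (r : ℂ))‖ = 1 := by
  rw [Complex.norm_exp]; simp

/-! ### The kernel of the Weyl transform -/

variable {n : ℕ}

theorem measurePreserving_fst_sub :
    MeasurePreserving (fun p : RSpace n × RSpace n => (p.1, p.2 - p.1)) volume volume :=
  (MeasurePreserving.id (volume : Measure (RSpace n))).skew_product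
    (g := fun a b => b - a) (by fun_prop)
    (Filter.Eventually.of_forall fun a => (measurePreserving_sub_right volume a).map_eq)

theorem measurePreserving_add_half_snd :
    MeasurePreserving (fun p : RSpace n × RSpace n => (p.1 + (1 / 2 : ℝ) • p.2, p.2))
      volume volume := by
  have h := (MeasurePreserving.id (volume : Measure (RSpace n))).skew_product
    (μc := (volume : Measure (RSpace n))) (μd := volume)
    (g := fun a b => b + (1 / 2 : ℝ) • a) (by fun_prop)
    (Filter.Eventually.of_forall fun a => (measurePreserving_add_right volume _).map_eq)
  exact Measure.measurePreserving_swap.comp (h.comp Measure.measurePreserving_swap)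

/-- The change of variables `(ξ, η) ↦ ((ξ + η) / 2, η - ξ)`. -/
theorem measurePreserving_midpoint_sub :
    MeasurePreserving
      (fun p : RSpace n × RSpace n => ((1 / 2 : ℝ) • (p.1 + p.2), p.2 - p.1)) volume volume := by
  -- A product of two shears: `ξ + (η - ξ)/2 = (ξ + η)/2`.
  have h := (measurePreserving_add_half_snd (n := n)).comp measurePreserving_fst_sub
  convert h using 2 with p
  simp only [Function.comp_apply, Prod.mk.injEq, and_true]
  module

theorem quasiMeasurePreserving_snd_sub_fst :
    Measure.QuasiMeasurePreserving (fun p : RSpace n × RSpace n => p.2 - p.1) volume volume :=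
  Measure.quasiMeasurePreserving_snd.comp measurePreserving_fst_sub.quasiMeasurePreserving

-- Since `πi x·(ξ + η) = 2πi x·((ξ + η)/2)`, the kernel is a partial inverse Fourier transform
-- evaluated at the midpoint.
open FourierTransform in
theorem weylKernelFun_eq_fourierInv (g : RSpace n × RSpace n → ℂ) (p : RSpace n × RSpace n) :
    weylKernelFun g p = 𝓕⁻ (fun x => g (x, p.2 - p.1)) ((1 / 2 : ℝ) • (p.1 + p.2)) := by
  rw [Real.fourierInv_eq', weylKernelFun]
  congr 1 with x
  rw [smul_eq_mul, mul_comm, inner_smul_right]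
  congr 2
  push_cast
  ring

theorem ae_ae_slice {P : RSpace n × RSpace n → Prop} (h : ∀ᵐ p, P p) :
    ∀ᵐ y : RSpace n, ∀ᵐ x : RSpace n, P (x, y) := by
  have h1 : ∀ᵐ p : RSpace n × RSpace n, P p.swap :=
    Measure.measurePreserving_swap.quasiMeasurePreserving.ae h
  exact Measure.ae_ae_of_ae_prod h1

/-- Almost every slice `g(·, y)` is unaffected by a null set, and `(ξ, η) ↦ η - ξ` pulls null sets
of `y` back to null sets. -/
theorem weylKernelFun_congr_ae {g g' : RSpace n × RSpace n → ℂ} (h : g =ᵐ[volume] g') :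
    weylKernelFun g =ᵐ[volume] weylKernelFun g' := by
  filter_upwards [quasiMeasurePreserving_snd_sub_fst.ae (ae_ae_slice h)] with p hp
  refine integral_congr_ae ?_
  filter_upwards [hp] with x hx
  rw [hx]

theorem weylKernelFun_add {g g' : RSpace n × RSpace n → ℂ} (h : Integrable g)
    (h' : Integrable g') :
    weylKernelFun (g + g') =ᵐ[volume] weylKernelFun g + weylKernelFun g' := by
  have key : ∀ {f : RSpace n × RSpace n → ℂ}, Integrable f → ∀ᵐ p : RSpace n × RSpace n,
      Integrable fun x : RSpace n => f (x, p.2 - p.1) *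
        Complex.exp (Real.pi * Complex.I * ((inner ℝ x (p.1 + p.2) : ℝ) : ℂ)) := by
    intro f hf
    filter_upwards [quasiMeasurePreserving_snd_sub_fst.ae hf.prod_left_ae] with p hp
    refine hp.mul_of_top_left ?_
    refine memLp_top_of_bound (Continuous.aestronglyMeasurable (by fun_prop)) 1
      (Filter.Eventually.of_forall fun x => (norm_exp_pi_mul_I _).le)
  filter_upwards [key h, key h'] with p hp hp'
  rw [Pi.add_apply, weylKernelFun, weylKernelFun, weylKernelFun, ← integral_add hp hp']
  simp only [Pi.add_apply, add_mul]

theorem weylKernelFun_const_smul (c : ℂ) (g : RSpace n × RSpace n → ℂ) :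
    weylKernelFun (c • g) = c • weylKernelFun g := by
  ext p
  simp only [weylKernelFun, Pi.smul_apply, smul_eq_mul, mul_assoc, integral_const_mul]

theorem stronglyMeasurable_weylKernelFun {g : RSpace n × RSpace n → ℂ}
    (hg : StronglyMeasurable g) : StronglyMeasurable (weylKernelFun g) := by
  have h : StronglyMeasurable fun q : (RSpace n × RSpace n) × RSpace n =>
      g (q.2, q.1.2 - q.1.1) *
        Complex.exp (Real.pi * Complex.I * ((inner ℝ q.2 (q.1.1 + q.1.2) : ℝ) : ℂ)) :=
    (hg.comp_measurable (by fun_prop)).mul (Continuous.stronglyMeasurable (by fun_prop))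
  exact h.integral_prod_right

theorem lintegral_enorm_sq_eq_eLpNorm_sq {α : Type*} [MeasurableSpace α] (μ : Measure α)
    (g : α → ℂ) : ∫⁻ x, ‖g x‖ₑ ^ 2 ∂μ = eLpNorm g 2 μ ^ 2 := by
  have := eLpNorm_nnreal_pow_eq_lintegral (f := g) (μ := μ) (p := 2) (by norm_num)
  simpa using this.symm

theorem memLp_two_slice {g : RSpace n × RSpace n → ℂ} (hg : MemLp g 2 volume) :
    ∀ᵐ y : RSpace n, MemLp (fun x => g (x, y)) 2 volume := by
  have h1 : Integrable (fun p => ‖g p‖ ^ 2) (volume : Measure (RSpace n × RSpace n)) :=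
    (memLp_two_iff_integrable_sq_norm hg.1).1 hg
  have h2 : ∀ᵐ y : RSpace n, AEStronglyMeasurable (fun x => g (x, y)) volume := by
    have := hg.1.comp_measurePreserving (Measure.measurePreserving_swap
      (μ := (volume : Measure (RSpace n))) (ν := (volume : Measure (RSpace n))))
    exact this.prodMk_left
  filter_upwards [h1.prod_left_ae, h2] with y hy hy2
  exact (memLp_two_iff_integrable_sq_norm hy2).2 hy

open FourierTransform in
theorem stronglyMeasurable_fourierInv_slice {g : RSpace n × RSpace n → ℂ}
    (hm : StronglyMeasurable g) :
    StronglyMeasurable fun q : RSpace n × RSpace n => 𝓕⁻ (fun x => g (x, q.2)) q.1 := by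
  have hc : Continuous fun q : (RSpace n × RSpace n) × RSpace n =>
      Complex.exp (((2 * Real.pi * inner ℝ q.2 q.1.1 : ℝ) : ℂ) * Complex.I) := by fun_prop
  have hmm : Measurable fun q : (RSpace n × RSpace n) × RSpace n => (q.2, q.1.2) := by fun_prop
  have h : StronglyMeasurable fun q : (RSpace n × RSpace n) × RSpace n =>
      Complex.exp (((2 * Real.pi * inner ℝ q.2 q.1.1 : ℝ) : ℂ) * Complex.I) *
        g (q.2, q.1.2) := hc.stronglyMeasurable.mul (hm.comp_measurable hmm)
  have h' := h.integral_prod_right' (ν := (volume : Measure (RSpace n)))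
  convert h' using 2 with q
  rw [Real.fourierInv_eq']
  simp only [smul_eq_mul]

open FourierTransform in
/-- Plancherel's theorem for the Weyl transform on `L¹ ∩ L²`. -/
theorem eLpNorm_weylKernelFun {g : RSpace n × RSpace n → ℂ} (hm : StronglyMeasurable g)
    (h1 : Integrable g) (h2 : MemLp g 2 volume) :
    eLpNorm (weylKernelFun g) 2 volume = eLpNorm g 2 volume := by
  obtain ⟨H, hH⟩ : ∃ H : RSpace n × RSpace n → ENNReal,
      ∀ q, H q = ‖𝓕⁻ (fun x => g (x, q.2)) q.1‖ₑ ^ 2 := ⟨_, fun _ => rfl⟩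
  have hHm : Measurable H := by
    rw [funext hH]
    exact (stronglyMeasurable_fourierInv_slice hm).measurable.enorm.pow_const 2
  have hsq : eLpNorm (weylKernelFun g) 2 volume ^ 2 = eLpNorm g 2 volume ^ 2 := by
    rw [← lintegral_enorm_sq_eq_eLpNorm_sq, ← lintegral_enorm_sq_eq_eLpNorm_sq]
    calc ∫⁻ p, ‖weylKernelFun g p‖ₑ ^ 2
        = ∫⁻ p : RSpace n × RSpace n, H ((1 / 2 : ℝ) • (p.1 + p.2), p.2 - p.1) := by
          simp only [hH, weylKernelFun_eq_fourierInv]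
      _ = ∫⁻ q, H q := measurePreserving_midpoint_sub.lintegral_comp hHm
      _ = ∫⁻ y, ∫⁻ x, H (x, y) := lintegral_prod_symm _ hHm.aemeasurable
      _ = ∫⁻ y, ∫⁻ x, ‖g (x, y)‖ₑ ^ 2 := by
          refine lintegral_congr_ae ?_
          filter_upwards [h1.prod_left_ae, memLp_two_slice h2] with y hy1 hy2
          simp only [hH]
          exact lintegral_enorm_sq_fourierInv hy1 hy2
      _ = ∫⁻ p, ‖g p‖ₑ ^ 2 :=
          (lintegral_prod_symm _ (hm.measurable.enorm.pow_const 2).aemeasurable).symm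
  exact (ENNReal.pow_right_strictMono two_ne_zero).injective hsq

theorem memLp_weylKernelFun {g : L2R2 n} (hg : Integrable g) :
    MemLp (weylKernelFun g) 2 volume :=
  ⟨(stronglyMeasurable_weylKernelFun (Lp.stronglyMeasurable g)).aestronglyMeasurable, by
    rw [eLpNorm_weylKernelFun (Lp.stronglyMeasurable g) hg (Lp.memLp g)]
    exact (Lp.memLp g).2⟩

theorem weylKernelL1_eq_toLp {g : L2R2 n} (hg : Integrable g) :
    weylKernelL1 g = (memLp_weylKernelFun hg).toLp :=
  dif_pos _

theorem coeFn_weylKernelL1 {g : L2R2 n} (hg : Integrable g) :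
    weylKernelL1 g =ᵐ[volume] weylKernelFun g := by
  rw [weylKernelL1_eq_toLp hg]; exact MemLp.coeFn_toLp _

theorem norm_weylKernelL1 {g : L2R2 n} (hg : Integrable g) : ‖weylKernelL1 g‖ = ‖g‖ := by
  rw [weylKernelL1_eq_toLp hg, Lp.norm_toLp,
    eLpNorm_weylKernelFun (Lp.stronglyMeasurable g) hg (Lp.memLp g), Lp.norm_def]

variable (n) in
/-- `L¹ ∩ L²` as a subspace of `L²`. -/
def integrableSubmodule : Submodule ℂ (L2R2 n) where
  carrier := {g : L2R2 n | Integrable (g : RSpace n × RSpace n → ℂ) volume}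
  add_mem' {f g} hf hg := (integrable_congr (Lp.coeFn_add f g)).2 (Integrable.add hf hg)
  zero_mem' := (integrable_congr (Lp.coeFn_zero ℂ 2 volume)).2 (integrable_zero _ _ _)
  smul_mem' c f hf := (integrable_congr (Lp.coeFn_smul c f)).2 (Integrable.smul c hf)

/-- Schwartz functions are integrable and already dense in `L²`. -/
theorem dense_integrableSubmodule : Dense (integrableSubmodule n : Set (L2R2 n)) := by
  have : (volume : Measure (RSpace n × RSpace n)).IsAddHaarMeasure :=
    inferInstanceAs
      ((volume : Measure (RSpace n)).prod (volume : Measure (RSpace n))).IsAddHaarMeasure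
  have h : DenseRange (SchwartzMap.toLpCLM ℝ (E := RSpace n × RSpace n) ℂ 2 volume) :=
    SchwartzMap.denseRange_toLpCLM ENNReal.ofNat_ne_top
  refine Dense.mono ?_ h
  rintro _ ⟨f, rfl⟩
  exact (integrable_congr (f.coeFn_toLp 2 volume)).2 f.integrable

variable (n) in
/-- The map `g ↦ K_g` on `L¹ ∩ L²`. -/
def weylKernelLinear : integrableSubmodule n →ₗ[ℂ] L2R2 n where
  toFun g := weylKernelL1 g
  map_add' f g := by
    ext1
    filter_upwards [coeFn_weylKernelL1 (f + g).2, coeFn_weylKernelL1 f.2, coeFn_weylKernelL1 g.2,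
      Lp.coeFn_add (weylKernelL1 (f : L2R2 n)) (weylKernelL1 (g : L2R2 n)),
      weylKernelFun_congr_ae (Lp.coeFn_add (f : L2R2 n) (g : L2R2 n)),
      weylKernelFun_add f.2 g.2] with p h1 h2 h3 h4 h5 h6
    rw [h1, h4, Pi.add_apply, h2, h3, Submodule.coe_add, h5, h6, Pi.add_apply]
  map_smul' c f := by
    ext1
    filter_upwards [coeFn_weylKernelL1 (c • f).2, coeFn_weylKernelL1 f.2,
      Lp.coeFn_smul c (weylKernelL1 (f : L2R2 n)),
      weylKernelFun_congr_ae (Lp.coeFn_smul c (f : L2R2 n))] with p h1 h2 h4 h5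
    rw [h1, RingHom.id_apply, h4, Pi.smul_apply, h2, Submodule.coe_smul, h5,
      weylKernelFun_const_smul, Pi.smul_apply]

theorem denseRange_integrableSubmodule_subtype : DenseRange (integrableSubmodule n).subtype := by
  rw [DenseRange]
  convert dense_integrableSubmodule (n := n)
  simp

variable (n) in
/-- The continuous extension of `g ↦ K_g` to `L²`, as a linear isometry. -/
def weylKernelIsometry : L2R2 n →ₗᵢ[ℂ] L2R2 n where
  toLinearMap := ((weylKernelLinear n).extendOfNorm (integrableSubmodule n).subtype).toLinearMap
  norm_map' := by
    refine denseRange_integrableSubmodule_subtype.induction ?_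
      (isClosed_eq (by simp only [ContinuousLinearMap.coe_coe]; fun_prop) (by fun_prop))
    rintro _ ⟨g, rfl⟩
    rw [ContinuousLinearMap.coe_coe, LinearMap.extendOfNorm_eq
      denseRange_integrableSubmodule_subtype ⟨1, fun f => by
        rw [one_mul]; exact (norm_weylKernelL1 f.2).le⟩]
    exact norm_weylKernelL1 g.2

theorem weylKernelIsometry_eq_weylKernelL1 {g : L2R2 n} (hg : Integrable g) :
    weylKernelIsometry n g = weylKernelL1 g :=
  LinearMap.extendOfNorm_eq denseRange_integrableSubmodule_subtype
    ⟨1, fun f => by rw [one_mul]; exact (norm_weylKernelL1 f.2).le⟩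
    (⟨g, hg⟩ : integrableSubmodule n)

/-- `extendFrom` is a limit along the dense subspace, hence is computed by any continuous map that
agrees with `weylKernelL1` there. -/
theorem weylKernel_eq_weylKernelIsometry (φ : L2R2 n) :
    weylKernel φ = weylKernelIsometry n φ := by
  refine extendFrom_eq (dense_integrableSubmodule φ) ?_
  refine ((weylKernelIsometry n).continuous.tendsto φ |>.mono_left nhdsWithin_le_nhds).congr' ?_
  filter_upwards [self_mem_nhdsWithin] with g hg
  exact weylKernelIsometry_eq_weylKernelL1 hg

/-! ### Covariance of the kernel under twisted translations -/

theorem coeFn_twistedTranslate (k l : Fin n → ℤ) (φ : L2R2 n) :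
    twistedTranslate k l φ =ᵐ[volume] twistedTranslateFun k l φ :=
  MemLp.coeFn_toLp _

/-- Substitute `x + k` for `x`. The factor `e^{πi x·l}` moves `ξ` to `ξ + l`; in the remaining phase
`k·(ξ + η) + k·l - (η - ξ)·k` the variable `η` cancels. -/
theorem weylKernelFun_twistedTranslateFun (k l : Fin n → ℤ) (φ : RSpace n × RSpace n → ℂ)
    (p : RSpace n × RSpace n) :
    weylKernelFun (twistedTranslateFun k l φ) p =
      Complex.exp (Real.pi * Complex.I *
        ((inner ℝ (intVec k) (intVec l) + 2 * inner ℝ (intVec k) p.1 : ℝ) : ℂ)) *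
        weylKernelFun φ (intVec l + p.1, p.2) := by
  simp only [weylKernelFun, twistedTranslateFun]
  rw [← integral_const_mul, ← integral_add_right_eq_self _ (intVec k)]
  congr 1 with x
  simp only [add_sub_cancel_right]
  have e : p.2 - p.1 - intVec l = p.2 - (intVec l + p.1) := by abel
  rw [e, mul_right_comm, ← Complex.exp_add, mul_left_comm, ← Complex.exp_add, mul_comm]
  congr 2
  rw [← mul_add, ← mul_add, ← Complex.ofReal_add, ← Complex.ofReal_add]
  congr 2
  simp only [inner_add_left, inner_add_right, inner_sub_right, real_inner_comm (intVec k)]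
  ring

theorem measurePreserving_intVec_add_fst (l : Fin n → ℤ) :
    MeasurePreserving (fun p : RSpace n × RSpace n => (intVec l + p.1, p.2)) volume volume :=
  (measurePreserving_add_left (volume : Measure (RSpace n)) (intVec l)).prod
    (MeasurePreserving.id volume)

/-- The twisted translation as a linear isometry. -/
def twistedTranslateIsometry (k l : Fin n → ℤ) : L2R2 n →ₗᵢ[ℂ] L2R2 n :=
  weightedComp (fun p : RSpace n × RSpace n => (p.1 - intVec k, p.2 - intVec l))
    ((measurePreserving_sub_right (volume : Measure (RSpace n)) (intVec k)).prod
      (measurePreserving_sub_right (volume : Measure (RSpace n)) (intVec l)))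
    (fun p => Complex.exp (Real.pi * Complex.I *
      ((inner ℝ p.1 (intVec l) - inner ℝ p.2 (intVec k) : ℝ) : ℂ)))
    (Continuous.aestronglyMeasurable (by fun_prop)) (fun _ => norm_exp_pi_mul_I _)

theorem twistedTranslateIsometry_apply (k l : Fin n → ℤ) (φ : L2R2 n) :
    twistedTranslateIsometry k l φ = twistedTranslate k l φ := rfl

/-- The action of `T^t_{(k,l)}` on kernels. -/
def kernelTranslate (k l : Fin n → ℤ) : L2R2 n →ₗᵢ[ℂ] L2R2 n :=
  weightedComp (fun p : RSpace n × RSpace n => (intVec l + p.1, p.2))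
    (measurePreserving_intVec_add_fst l)
    (fun p => Complex.exp (Real.pi * Complex.I *
      ((inner ℝ (intVec k) (intVec l) + 2 * inner ℝ (intVec k) p.1 : ℝ) : ℂ)))
    (Continuous.aestronglyMeasurable (by fun_prop)) (fun _ => norm_exp_pi_mul_I _)

theorem integrable_twistedTranslate (k l : Fin n → ℤ) {φ : L2R2 n} (hφ : Integrable φ) :
    Integrable (twistedTranslate k l φ) := by
  refine (integrable_congr (coeFn_twistedTranslate k l φ)).2 ?_
  have h1 : MeasurePreserving
      (fun p : RSpace n × RSpace n => (p.1 - intVec k, p.2 - intVec l)) volume volume :=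
    (measurePreserving_sub_right (volume : Measure (RSpace n)) (intVec k)).prod
      (measurePreserving_sub_right (volume : Measure (RSpace n)) (intVec l))
  refine (h1.integrable_comp_of_integrable hφ).mul_of_top_right ?_
  exact memLp_top_of_bound (Continuous.aestronglyMeasurable (by fun_prop)) 1
    (Filter.Eventually.of_forall fun x => (norm_exp_pi_mul_I _).le)

/-- Both sides are continuous in `φ`, so the pointwise formula on `L¹ ∩ L²` suffices. -/
theorem weylKernel_twistedTranslate (k l : Fin n → ℤ) (φ : L2R2 n) :
    weylKernel (twistedTranslate k l φ) = kernelTranslate k l (weylKernel φ) := by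
  simp only [weylKernel_eq_weylKernelIsometry, ← twistedTranslateIsometry_apply]
  refine dense_integrableSubmodule.induction (P := fun φ =>
    weylKernelIsometry n (twistedTranslateIsometry k l φ) =
      kernelTranslate k l (weylKernelIsometry n φ)) ?_
    (isClosed_eq (by fun_prop) (by fun_prop)) φ
  intro g hg
  have hg : Integrable g := hg
  have hT := integrable_twistedTranslate k l hg
  rw [twistedTranslateIsometry_apply, weylKernelIsometry_eq_weylKernelL1 hg,
    weylKernelIsometry_eq_weylKernelL1 hT]
  ext1
  filter_upwards [coeFn_weylKernelL1 hT,
    weylKernelFun_congr_ae (coeFn_twistedTranslate k l g),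
    coeFn_weightedComp _ (measurePreserving_intVec_add_fst l) _ _ _ (weylKernelL1 g),
    (measurePreserving_intVec_add_fst l).quasiMeasurePreserving.ae (coeFn_weylKernelL1 hg)]
    with p h1 h2 h3 h4
  rw [h1, h2, weylKernelFun_twistedTranslateFun, kernelTranslate, h3, h4]

/-! ### The Weyl-Zak transform -/

theorem inner_intVec (k : Fin n → ℤ) (x : RSpace n) :
    inner ℝ (intVec k) x = ∑ i, (k i : ℝ) * x i := by
  simp [intVec, PiLp.inner_apply, mul_comm]

theorem intVec_add (k l : Fin n → ℤ) : intVec (k + l) = intVec k + intVec l := by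
  ext i; simp [intVec]

theorem intVec_sub (k l : Fin n → ℤ) : intVec (k - l) = intVec k - intVec l := by
  ext i; simp [intVec]

theorem measurableSet_torusCube : MeasurableSet (torusCube n) := by
  have : torusCube n = ⋂ i, (fun ξ : RSpace n => ξ i) ⁻¹' Set.Ico (0 : ℝ) 1 := by
    ext ξ; simp [torusCube]
  rw [this]
  exact MeasurableSet.iInter fun i => measurableSet_Ico.preimage (by fun_prop)

theorem integral_exp_int_mul (k : ℤ) :
    ∫ t in Set.Ico (0 : ℝ) 1, Complex.exp (2 * Real.pi * Complex.I * ((k * t : ℝ) : ℂ)) =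
      if k = 0 then 1 else 0 := by
  split_ifs with h
  · simp [h]
  · rw [integral_Ico_eq_integral_Ioc, ← intervalIntegral.integral_of_le zero_le_one]
    have hc : (2 * Real.pi * Complex.I * k : ℂ) ≠ 0 := by
      simp [Real.pi_ne_zero, h]
    have h2 := integral_exp_mul_complex (a := 0) (b := 1) hc
    have h3 : Complex.exp (2 * Real.pi * Complex.I * k) = 1 :=
      Complex.exp_eq_one_iff.2 ⟨k, by ring⟩
    simp only [Complex.ofReal_one, mul_one, Complex.ofReal_zero, mul_zero, Complex.exp_zero, h3,
      sub_self, zero_div] at h2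
    rw [← h2]
    congr 1 with t
    push_cast
    ring_nf

theorem integral_exp_inner_intVec (k : Fin n → ℤ) :
    ∫ ξ, Complex.exp (2 * Real.pi * Complex.I * ((inner ℝ (intVec k) ξ : ℝ) : ℂ))
      ∂(torusMeasure n) = if k = 0 then 1 else 0 := by
  have hpre : torusCube n = (MeasurableEquiv.toLp 2 (Fin n → ℝ)).symm ⁻¹'
      (Set.univ.pi fun _ => Set.Ico (0 : ℝ) 1) := by
    ext ξ; simp [torusCube]
  have h := (EuclideanSpace.volume_preserving_symm_measurableEquiv_toLp (Fin n)
    ).setIntegral_preimage_emb (MeasurableEquiv.measurableEmbedding _)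
    (fun x : Fin n → ℝ => ∏ i, Complex.exp (2 * Real.pi * Complex.I * ((k i * x i : ℝ) : ℂ)))
    (Set.univ.pi fun _ => Set.Ico (0 : ℝ) 1)
  rw [← hpre, volume_pi, Measure.restrict_pi_pi, integral_fintype_prod_eq_prod
    (f := fun i t => Complex.exp (2 * Real.pi * Complex.I * ((k i * t : ℝ) : ℂ)))] at h
  simp only [integral_exp_int_mul] at h
  rw [torusMeasure]
  convert h using 1
  · congr 1 with ξ
    rw [← Complex.exp_sum, ← Finset.mul_sum, inner_intVec]
    push_cast
    rfl
  · rw [Finset.prod_ite_zero]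
    simp [funext_iff]

/-- Reordering the coordinates as `((ξ, η), ξ')` separates the variables. -/
theorem integral_zakMeasure_mul (F : RSpace n × RSpace n → ℂ) (G : RSpace n → ℂ) :
    ∫ p, F (p.1.1, p.2) * G p.1.2 ∂(zakMeasure n) =
      (∫ q, F q ∂((torusMeasure n).prod volume)) * ∫ ξ', G ξ' ∂(torusMeasure n) := by
  have h1 := measurePreserving_prodAssoc (torusMeasure n) (torusMeasure n)
    (volume : Measure (RSpace n))
  have h2 : MeasurePreserving (MeasurableEquiv.prodCongr (MeasurableEquiv.refl (RSpace n))
      (MeasurableEquiv.prodComm (α := RSpace n) (β := RSpace n)))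
      ((torusMeasure n).prod ((torusMeasure n).prod volume))
      ((torusMeasure n).prod ((volume : Measure (RSpace n)).prod (torusMeasure n))) :=
    (MeasurePreserving.id _).prod Measure.measurePreserving_swap
  have h3 := (measurePreserving_prodAssoc (torusMeasure n) (volume : Measure (RSpace n))
    (torusMeasure n)).symm
  have h := (h3.comp (h2.comp h1)).integral_comp
    ((MeasurableEquiv.measurableEmbedding _).comp
      ((MeasurableEquiv.measurableEmbedding _).comp (MeasurableEquiv.measurableEmbedding _)))
    (fun q : (RSpace n × RSpace n) × RSpace n => F q.1 * G q.2)
  rw [integral_prod_mul] at h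
  rw [← h]
  rfl

theorem measurableEmbedding_intVec_add_fst (m : Fin n → ℤ) :
    MeasurableEmbedding (fun p : RSpace n × RSpace n => (intVec m + p.1, p.2)) :=
  ((Homeomorph.addLeft (intVec m)).prodCongr (Homeomorph.refl (RSpace n))).measurableEmbedding

theorem torusMeasure_prod_volume :
    (torusMeasure n).prod (volume : Measure (RSpace n)) =
      (volume : Measure (RSpace n × RSpace n)).restrict (torusCube n ×ˢ Set.univ) := by
  rw [Measure.volume_eq_prod, ← Measure.prod_restrict, Measure.restrict_univ, torusMeasure]

/-- Integration over `ℝⁿ × ℝⁿ` is summation over the translates of the fundamental domain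
`[0,1)ⁿ × ℝⁿ`. -/
theorem hasSum_integral_torusCube {F : RSpace n × RSpace n → ℂ} (hF : Integrable F) :
    HasSum (fun m : Fin n → ℤ => ∫ p, F (intVec m + p.1, p.2) ∂((torusMeasure n).prod volume))
      (∫ p, F p) := by
  -- The strips on which the first coordinate has integer part `m`.
  let S : (Fin n → ℤ) → Set (RSpace n × RSpace n) := fun m => {p | ∀ i, ⌊p.1 i⌋ = m i}
  have hS : ∀ m, MeasurableSet (S m) := fun m => by
    have : S m = ⋂ i, (fun p : RSpace n × RSpace n => ⌊p.1 i⌋) ⁻¹' {m i} := by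
      ext p; simp [S]
    rw [this]
    refine MeasurableSet.iInter fun i => (MeasurableSet.singleton _).preimage ?_
    exact Int.measurable_floor.comp (by fun_prop)
  have hd : Pairwise (Function.onFun Disjoint S) := fun m m' hm =>
    Set.disjoint_left.2 fun p hp hp' => hm (funext fun i => (hp i).symm.trans (hp' i))
  have hU : ⋃ m, S m = Set.univ :=
    Set.eq_univ_of_forall fun p => Set.mem_iUnion.2 ⟨fun i => ⌊p.1 i⌋, fun i => rfl⟩
  have h := hasSum_integral_iUnion hS hd (f := F) (μ := volume) hF.integrableOn
  rw [hU, setIntegral_univ] at h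
  have e : ∀ m, ∫ p, F (intVec m + p.1, p.2) ∂((torusMeasure n).prod volume) =
      ∫ p in S m, F p := fun m => by
    rw [← (measurePreserving_intVec_add_fst m).setIntegral_preimage_emb
      (measurableEmbedding_intVec_add_fst m), torusMeasure_prod_volume]
    congr 2
    ext p
    simp only [Set.mem_prod, torusCube, Set.mem_ofPred_eq, Set.mem_univ, and_true,
      Set.mem_preimage, S, Set.mem_Ico]
    refine forall_congr' fun i => ?_
    simp [intVec, Int.floor_eq_zero_iff]
  simpa only [e] using h

theorem coeFn_zakTerm (m : Fin n → ℤ) (K : L2R2 n) :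
    zakTerm m K =ᵐ[zakMeasure n] zakTermFun m K :=
  MemLp.coeFn_toLp _

/-- The `ξ'`-integral of `e^{2πi(m - m')·ξ'}` removes the off-diagonal terms. -/
theorem inner_zakTerm (m m' : Fin n → ℤ) (K K' : L2R2 n) :
    inner ℂ (zakTerm m K) (zakTerm m' K') = if m = m' then
      ∫ p, inner ℂ (K (intVec m + p.1, p.2)) (K' (intVec m + p.1, p.2))
        ∂((torusMeasure n).prod volume) else 0 := by
  have h : inner ℂ (zakTerm m K) (zakTerm m' K') =
      ∫ p, inner ℂ (K (intVec m + p.1.1, p.2)) (K' (intVec m' + p.1.1, p.2)) *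
        Complex.exp (2 * Real.pi * Complex.I * ((inner ℝ (intVec (m - m')) p.1.2 : ℝ) : ℂ))
        ∂(zakMeasure n) := by
    rw [L2.inner_def]
    refine integral_congr_ae ?_
    filter_upwards [coeFn_zakTerm m K, coeFn_zakTerm m' K'] with p h1 h2
    rw [h1, h2]
    simp only [zakTermFun, RCLike.inner_apply, map_mul, ← Complex.exp_conj, intVec_sub,
      inner_sub_left]
    rw [mul_mul_mul_comm, ← Complex.exp_add]
    congr 2
    simp [map_ofNat (starRingEnd ℂ) 2]
    ring
  refine h.trans ((integral_zakMeasure_mul (fun q => inner ℂ (K (intVec m + q.1, q.2))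
    (K' (intVec m' + q.1, q.2))) fun ξ' =>
      Complex.exp (2 * Real.pi * Complex.I * ((inner ℝ (intVec (m - m')) ξ' : ℝ) : ℂ))).trans ?_)
  rw [integral_exp_inner_intVec]
  simp only [sub_eq_zero]
  split_ifs with hm
  · subst hm; rw [mul_one]
  · rw [mul_zero]

theorem hasSum_inner_zakTerm (K K' : L2R2 n) :
    HasSum (fun m : Fin n → ℤ => inner ℂ (zakTerm m K) (zakTerm m K')) (inner ℂ K K') := by
  simp only [inner_zakTerm, if_true]
  rw [L2.inner_def]
  exact hasSum_integral_torusCube (L2.integrable_inner K K')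

theorem summable_zakTerm (K : L2R2 n) : Summable fun m : Fin n → ℤ => zakTerm m K := by
  -- Each term is replaced by the line it spans, so that summability reduces to that of the squared
  -- norms.
  have hV : OrthogonalFamily ℂ (fun m : Fin n → ℤ => (Submodule.span ℂ {zakTerm m K}))
      fun m => (Submodule.span ℂ {zakTerm m K}).subtypeₗᵢ := by
    intro m m' hm v w
    obtain ⟨a, ha⟩ := Submodule.mem_span_singleton.1 v.2
    obtain ⟨b, hb⟩ := Submodule.mem_span_singleton.1 w.2
    change inner ℂ (v : L2Zak n) (w : L2Zak n) = 0
    rw [← ha, ← hb, inner_smul_left, inner_smul_right, inner_zakTerm, if_neg hm, mul_zero,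
      mul_zero]
  have h := (hV.summable_iff_norm_sq_summable
    fun m => ⟨zakTerm m K, Submodule.mem_span_singleton_self _⟩).2
  refine h ?_
  have h2 := (hasSum_inner_zakTerm K K).summable.norm
  refine h2.congr fun m => ?_
  simp [inner_self_eq_norm_sq_to_K]

/-- The Zak series defines an isometry. -/
theorem inner_tsum_zakTerm (K K' : L2R2 n) :
    inner ℂ (∑' m : Fin n → ℤ, zakTerm m K) (∑' m : Fin n → ℤ, zakTerm m K') = inner ℂ K K' := by
  have h1 : ∀ m : Fin n → ℤ, inner ℂ (zakTerm m K) (∑' m' : Fin n → ℤ, zakTerm m' K') =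
      inner ℂ (zakTerm m K) (zakTerm m K') := fun m => by
    have h := (innerSL ℂ (zakTerm m K)).map_tsum (summable_zakTerm K')
    simp only [innerSL_apply_apply] at h
    rw [h, tsum_eq_single m fun m' hm => by rw [inner_zakTerm, if_neg hm.symm]]
  have h2 := (innerSLFlip ℂ (∑' m' : Fin n → ℤ, zakTerm m' K')).map_tsum (summable_zakTerm K)
  simp only [innerSLFlip_apply_apply, h1] at h2
  rw [h2, (hasSum_inner_zakTerm K K').tsum_eq]

theorem inner_weylZak (φ ψ : L2R2 n) : inner ℂ (weylZak φ) (weylZak ψ) = inner ℂ φ ψ := by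
  rw [weylZak, weylZak, inner_tsum_zakTerm, weylKernel_eq_weylKernelIsometry,
    weylKernel_eq_weylKernelIsometry, LinearIsometry.inner_map_map]

/-! ### Twisted translations as modulations -/

/-- The unimodular factor by which `T^t_{(k,l)}` acts on the Weyl-Zak side. -/
def zakPhase (k l : Fin n → ℤ) (p : RSpace n × RSpace n) : ℂ :=
  Complex.exp (Real.pi * Complex.I * ((inner ℝ (intVec k) (intVec l) +
    2 * inner ℝ (intVec k) p.1 + 2 * inner ℝ (intVec l) p.2 : ℝ) : ℂ))

theorem continuous_zakPhase (k l : Fin n → ℤ) : Continuous (zakPhase k l) := by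
  unfold zakPhase; fun_prop

theorem norm_zakPhase (k l : Fin n → ℤ) (p : RSpace n × RSpace n) : ‖zakPhase k l p‖ = 1 :=
  norm_exp_pi_mul_I _

/-- Multiplication by `zakPhase`. -/
def zakModulation (k l : Fin n → ℤ) : L2Zak n →ₗᵢ[ℂ] L2Zak n :=
  weightedComp id (MeasurePreserving.id _) (fun p => zakPhase k l p.1)
    ((continuous_zakPhase k l).comp continuous_fst).aestronglyMeasurable
    (fun _ => norm_zakPhase _ _ _)

theorem quasiMeasurePreserving_zak (m : Fin n → ℤ) :
    Measure.QuasiMeasurePreserving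
      (fun p : (RSpace n × RSpace n) × RSpace n => (intVec m + p.1.1, p.2)) (zakMeasure n)
      volume := by
  have h1 : MeasurePreserving
      (fun p : (RSpace n × RSpace n) × RSpace n => (p.1.1, p.2)) (zakMeasure n)
      ((torusMeasure n).prod volume) :=
    measurePreserving_fst.prod (MeasurePreserving.id volume)
  have h2 := (measurePreserving_intVec_add_fst (n := n) m).quasiMeasurePreserving.mono_left
    (μa' := (torusMeasure n).prod volume)
    (by rw [torusMeasure_prod_volume]; exact Measure.restrict_le_self.absolutelyContinuous)
  exact h2.comp h1.quasiMeasurePreserving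

theorem exp_pi_mul_I_two_mul_inner_intVec (k m : Fin n → ℤ) :
    Complex.exp (Real.pi * Complex.I * ((2 * inner ℝ (intVec k) (intVec m) : ℝ) : ℂ)) = 1 := by
  refine Complex.exp_eq_one_iff.2 ⟨∑ i, k i * m i, ?_⟩
  rw [inner_intVec]
  simp only [intVec]
  push_cast
  ring

/-- Shifting `ξ` by `l` turns index `m` into `m + l`, and `e^{-2πi m·ξ'} = e^{2πi l·ξ'} e^{-2πi(m +
l)·ξ'}`. The extra factor `e^{2πi k·m}` from evaluating the phase at `m + ξ` is `1`. -/
theorem zakTerm_kernelTranslate (m k l : Fin n → ℤ) (K : L2R2 n) :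
    zakTerm m (kernelTranslate k l K) = zakModulation k l (zakTerm (m + l) K) := by
  ext1
  filter_upwards [coeFn_zakTerm m (kernelTranslate k l K), coeFn_zakTerm (m + l) K,
    coeFn_weightedComp id (MeasurePreserving.id (zakMeasure n)) _
      ((continuous_zakPhase k l).comp continuous_fst).aestronglyMeasurable
      (fun _ => norm_zakPhase _ _ _) (zakTerm (m + l) K),
    (quasiMeasurePreserving_zak m).ae (coeFn_weightedComp _ (measurePreserving_intVec_add_fst l)
      (fun p => Complex.exp (Real.pi * Complex.I *
        ((inner ℝ (intVec k) (intVec l) + 2 * inner ℝ (intVec k) p.1 : ℝ) : ℂ)))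
      (Continuous.aestronglyMeasurable (by fun_prop)) (fun _ => norm_exp_pi_mul_I _) K)]
    with p h1 h2 h3 h4
  rw [h1, zakModulation]
  refine Eq.trans ?_ h3.symm
  rw [id, h2, zakTermFun, kernelTranslate, h4, zakTermFun, Function.comp_apply, zakPhase,
    intVec_add]
  have e : intVec l + (intVec m + p.1.1) = intVec m + intVec l + p.1.1 := by abel
  have e2 := exp_pi_mul_I_two_mul_inner_intVec k m
  rw [e, mul_right_comm, ← Complex.exp_add, mul_left_comm, ← Complex.exp_add, mul_comm]
  congr 1
  refine Eq.trans ?_ (mul_one _)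
  rw [← e2, ← Complex.exp_add]
  congr 1
  simp only [inner_add_left, inner_add_right]
  push_cast
  ring

/-- The phase does not depend on `m`, so it leaves the series, and reindexing absorbs the shift by
`l`. -/
theorem weylZak_twistedTranslate (k l : Fin n → ℤ) (φ : L2R2 n) :
    weylZak (twistedTranslate k l φ) = zakModulation k l (weylZak φ) := by
  rw [weylZak, weylKernel_twistedTranslate]
  simp only [zakTerm_kernelTranslate]
  have h : Summable fun m : Fin n → ℤ => zakTerm (m + l) (weylKernel φ) :=
    (summable_zakTerm (weylKernel φ)).comp_injective (add_left_injective l)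
  have h1 := (zakModulation k l).toContinuousLinearMap.map_tsum h
  rw [LinearIsometry.coe_toContinuousLinearMap] at h1
  rw [← h1, weylZak]
  have h2 := (Equiv.addRight l).tsum_eq fun m => zakTerm m (weylKernel φ)
  simp only [Equiv.coe_addRight] at h2
  rw [h2]

/-! ### Uniqueness of Fourier coefficients -/

open UnitAddTorus in
/-- An integrable function on the torus, with respect to any finite measure, whose integrals
against all characters vanish is zero almost everywhere. -/
theorem ae_eq_zero_of_forall_integral_mFourier {d : Type*} [Fintype d]
    {ν : Measure (UnitAddTorus d)} [IsFiniteMeasure ν] {H : UnitAddTorus d → ℂ}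
    (hH : Integrable H ν) (h : ∀ k : d → ℤ, ∫ x, mFourier k x * H x ∂ν = 0) :
    H =ᵐ[ν] 0 := by
  have hint : ∀ f : C(UnitAddTorus d, ℂ), Integrable (fun x => f x * H x) ν := fun f =>
    hH.mul_of_top_right (memLp_top_of_bound f.continuous.aestronglyMeasurable ‖f‖
      (Filter.Eventually.of_forall f.norm_coe_le_norm))
  let L : C(UnitAddTorus d, ℂ) →L[ℂ] ℂ := LinearMap.mkContinuous
    { toFun := fun f => ∫ x, f x * H x ∂ν
      map_add' := fun f g => by
        simp only [ContinuousMap.add_apply, add_mul]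
        exact integral_add (hint f) (hint g)
      map_smul' := fun c f => by
        simp only [ContinuousMap.smul_apply, smul_eq_mul, mul_assoc, RingHom.id_apply,
          integral_const_mul] }
    (∫ x, ‖H x‖ ∂ν) fun f => by
      simp only [LinearMap.coe_mk, AddHom.coe_mk]
      rw [mul_comm, ← integral_const_mul]
      refine norm_integral_le_of_norm_le (hH.norm.const_mul _)
        (Filter.Eventually.of_forall fun x => ?_)
      rw [norm_mul]
      exact mul_le_mul_of_nonneg_right (f.norm_coe_le_norm x) (norm_nonneg _)
  -- Trigonometric polynomials are uniformly dense, so the functional vanishes on all continuous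
  -- functions.
  have hL : ∀ f, L f = 0 := fun f => by
    have hle : (Submodule.span ℂ (Set.range (mFourier (d := d)))).topologicalClosure ≤
        LinearMap.ker L.toLinearMap := by
      refine Submodule.topologicalClosure_minimal _ (Submodule.span_le.2 ?_) L.isClosed_ker
      rintro _ ⟨k, rfl⟩
      exact h k
    rw [span_mFourier_closure_eq_top] at hle
    exact hle (Submodule.mem_top (x := f))
  -- Indicators of closed sets are pointwise limits of continuous functions bounded by `1`;
  -- dominated convergence with bound `‖H‖` applies.
  refine ae_eq_zero_of_forall_setIntegral_isClosed_eq_zero hH fun s hs => ?_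
  have htend : Filter.Tendsto (fun j => ∫ x, ((hs.apprSeq j x : ℝ) : ℂ) * H x ∂ν) Filter.atTop
      (nhds (∫ x in s, H x ∂ν)) := by
    rw [← integral_indicator hs.measurableSet]
    refine tendsto_integral_of_dominated_convergence (fun x => ‖H x‖) (fun j => ?_) hH.norm
      (fun j => Filter.Eventually.of_forall fun x => ?_)
      (Filter.Eventually.of_forall fun x => ?_)
    · exact (Continuous.aestronglyMeasurable (by fun_prop)).mul hH.1
    · rw [norm_mul]
      refine mul_le_of_le_one_left (norm_nonneg _) ?_
      have := HasOuterApproxClosed.apprSeq_apply_le_one hs j x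
      simpa using! this
    · have h1 := (tendsto_pi_nhds.1 (HasOuterApproxClosed.tendsto_apprSeq hs)) x
      have h2 : Filter.Tendsto (fun j => ((hs.apprSeq j x : ℝ) : ℂ) * H x) Filter.atTop
          (nhds ((((s.indicator (fun _ => (1 : NNReal)) x : NNReal) : ℝ) : ℂ) * H x)) :=
        ((Complex.continuous_ofReal.comp NNReal.continuous_coe).tendsto _ |>.comp h1).mul_const _
      convert h2 using 2
      by_cases hx : x ∈ s <;> simp [hx]
  have hz : ∀ j, ∫ x, ((hs.apprSeq j x : ℝ) : ℂ) * H x ∂ν = 0 := fun j =>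
    hL ⟨fun x => ((hs.apprSeq j x : ℝ) : ℂ), by fun_prop⟩
  simp only [hz] at htend
  exact (tendsto_nhds_unique tendsto_const_nhds htend).symm

/-- The projection of `ℝⁿ × ℝⁿ` onto the torus. -/
def toTorus (p : RSpace n × RSpace n) : UnitAddTorus (Fin n ⊕ Fin n) :=
  Sum.elim (fun i => (p.1 i : UnitAddCircle)) (fun i => (p.2 i : UnitAddCircle))

/-- The representative in `[0,1)ⁿ × [0,1)ⁿ` of a point of the torus. -/
def torusRep (x : UnitAddTorus (Fin n ⊕ Fin n)) : RSpace n × RSpace n :=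
  (WithLp.toLp 2 fun i => (AddCircle.measurableEquivIco (1 : ℝ) 0 (x (Sum.inl i)) : ℝ),
    WithLp.toLp 2 fun i => (AddCircle.measurableEquivIco (1 : ℝ) 0 (x (Sum.inr i)) : ℝ))

theorem continuous_toTorus : Continuous (toTorus (n := n)) := by
  refine continuous_pi fun i => ?_
  rcases i with i | i
  · exact (AddCircle.continuous_mk' 1).comp (by fun_prop)
  · exact (AddCircle.continuous_mk' 1).comp (by fun_prop)

theorem measurable_torusRep : Measurable (torusRep (n := n)) := by
  have h : ∀ i, Measurable fun x : UnitAddTorus (Fin n ⊕ Fin n) =>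
      (AddCircle.measurableEquivIco (1 : ℝ) 0 (x i) : ℝ) := fun i =>
    measurable_subtype_coe.comp
      ((AddCircle.measurableEquivIco (1 : ℝ) 0).measurable.comp (measurable_pi_apply i))
  exact ((WithLp.measurable_toLp 2 _).comp (measurable_pi_lambda _ fun i => h _)).prodMk
    ((WithLp.measurable_toLp 2 _).comp (measurable_pi_lambda _ fun i => h _))

theorem torusRep_toTorus {p : RSpace n × RSpace n} (h1 : p.1 ∈ torusCube n)
    (h2 : p.2 ∈ torusCube n) : torusRep (toTorus p) = p := by
  have h : ∀ {t : ℝ}, t ∈ Set.Ico (0 : ℝ) 1 →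
      (AddCircle.measurableEquivIco (1 : ℝ) 0 (t : UnitAddCircle) : ℝ) = t := fun {t} ht =>
    congrArg Subtype.val (AddCircle.equivIco_coe_eq (p := (1 : ℝ)) (a := 0) (by simpa using ht))
  ext i
  · exact h (h1 i)
  · exact h (h2 i)

theorem mFourier_toTorus (k l : Fin n → ℤ) (p : RSpace n × RSpace n) :
    UnitAddTorus.mFourier (Sum.elim k l) (toTorus p) =
      Complex.exp (2 * Real.pi * Complex.I *
        ((inner ℝ (intVec k) p.1 + inner ℝ (intVec l) p.2 : ℝ) : ℂ)) := by
  simp only [UnitAddTorus.mFourier, ContinuousMap.coe_mk, toTorus, Fintype.prod_sum_type,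
    Sum.elim_inl, Sum.elim_inr, fourier_coe_apply, ← Complex.exp_sum, ← Complex.exp_add,
    inner_intVec]
  congr 1
  push_cast
  simp only [mul_add, Finset.mul_sum]
  congr 1 <;> exact Finset.sum_congr rfl fun i _ => by ring

theorem ae_mem_torusCube : ∀ᵐ p ∂((torusMeasure n).prod (torusMeasure n)),
    p.1 ∈ torusCube n ∧ p.2 ∈ torusCube n := by
  have h : ∀ᵐ ξ ∂(torusMeasure n), ξ ∈ torusCube n := ae_restrict_mem measurableSet_torusCube
  exact (Measure.quasiMeasurePreserving_fst.ae h).and (Measure.quasiMeasurePreserving_snd.ae h)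

/-- An integrable function on `𝕋ⁿ × 𝕋ⁿ` all of whose Fourier coefficients vanish is zero almost
everywhere. -/
theorem ae_eq_zero_of_forall_integral_exp {h : RSpace n × RSpace n → ℂ}
    (hh : Integrable h ((torusMeasure n).prod (torusMeasure n)))
    (h0 : ∀ k l : Fin n → ℤ, ∫ p, Complex.exp (2 * Real.pi * Complex.I *
        ((inner ℝ (intVec k) p.1 + inner ℝ (intVec l) p.2 : ℝ) : ℂ)) * h p
      ∂((torusMeasure n).prod (torusMeasure n)) = 0) :
    h =ᵐ[(torusMeasure n).prod (torusMeasure n)] 0 := by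
  set μ := (torusMeasure n).prod (torusMeasure n)
  set g := hh.1.mk h
  have hg : StronglyMeasurable g := hh.1.stronglyMeasurable_mk
  have hgh : h =ᵐ[μ] g := hh.1.ae_eq_mk
  have hm : Measurable (toTorus (n := n)) := continuous_toTorus.measurable
  have hH : StronglyMeasurable (g ∘ torusRep) := hg.comp_measurable measurable_torusRep
  have hrep : ∀ᵐ p ∂μ, (g ∘ torusRep) (toTorus p) = h p := by
    filter_upwards [hgh, ae_mem_torusCube] with p h1 h2
    rw [Function.comp_apply, torusRep_toTorus h2.1 h2.2, h1]
  -- The torus carries the pushforward of `μ`; uniqueness holds for any finite measure, so this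
  -- pushforward need not be identified with Haar measure.
  have hI : Integrable (g ∘ torusRep) (μ.map toTorus) :=
    (integrable_map_measure hH.aestronglyMeasurable hm.aemeasurable).2
      ((integrable_congr hrep).2 hh)
  have key := ae_eq_zero_of_forall_integral_mFourier hI fun k => by
    obtain ⟨k₁, k₂, rfl⟩ : ∃ k₁ k₂, k = Sum.elim k₁ k₂ :=
      ⟨k ∘ Sum.inl, k ∘ Sum.inr, (Sum.elim_comp_inl_inr k).symm⟩
    refine (integral_map hm.aemeasurable
      ((UnitAddTorus.mFourier _).continuous.aestronglyMeasurable.mul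
        hH.aestronglyMeasurable)).trans ?_
    rw [← h0 k₁ k₂]
    refine integral_congr_ae ?_
    filter_upwards [hrep] with p hp
    rw [Pi.mul_apply, hp, mFourier_toTorus]
  filter_upwards [ae_of_ae_map hm.aemeasurable key, hrep] with p h1 h2
  rw [← h2, h1]
  rfl

/-! ### The map `𝒥` and orthogonality of principal spaces -/

theorem ae_memLp_weylZak (φ : L2R2 n) :
    ∀ᵐ p ∂((torusMeasure n).prod (torusMeasure n)),
      MemLp (fun η : RSpace n => weylZak φ (p, η)) 2 volume := by
  have h1 : Integrable (fun q => ‖weylZak φ q‖ ^ 2) (zakMeasure n) :=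
    (memLp_two_iff_integrable_sq_norm (Lp.memLp _).1).1 (Lp.memLp _)
  filter_upwards [h1.prod_right_ae, (Lp.memLp (weylZak φ)).1.prodMk_left] with p hp hp2
  exact (memLp_two_iff_integrable_sq_norm hp2).2 hp

theorem ae_inner_jMap (φ ψ : L2R2 n) :
    ∀ᵐ p ∂((torusMeasure n).prod (torusMeasure n)), inner ℂ (jMap φ p) (jMap ψ p) =
      ∫ η : RSpace n, inner ℂ (weylZak φ (p, η)) (weylZak ψ (p, η)) := by
  filter_upwards [ae_memLp_weylZak φ, ae_memLp_weylZak ψ] with p h1 h2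
  rw [jMap, jMap, dif_pos h1, dif_pos h2, L2.inner_def]
  refine integral_congr_ae ?_
  filter_upwards [h1.coeFn_toLp, h2.coeFn_toLp] with η h3 h4
  rw [h3, h4]

theorem integrable_inner_jMap (φ ψ : L2R2 n) :
    Integrable (fun p => inner ℂ (jMap φ p) (jMap ψ p))
      ((torusMeasure n).prod (torusMeasure n)) :=
  (integrable_congr (ae_inner_jMap φ ψ)).2
    (L2.integrable_inner (𝕜 := ℂ) (weylZak φ) (weylZak ψ)).integral_prod_left

theorem coeFn_zakModulation (k l : Fin n → ℤ) (f : L2Zak n) :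
    zakModulation k l f =ᵐ[zakMeasure n] fun q => zakPhase k l q.1 * f q :=
  coeFn_weightedComp id (MeasurePreserving.id (zakMeasure n)) (fun q => zakPhase k l q.1)
    ((continuous_zakPhase k l).comp continuous_fst).aestronglyMeasurable
    (fun _ => norm_zakPhase _ _ _) f

/-- The phases are independent of `η`, so they come out of the inner integral over `ℝⁿ`, which is
`⟨𝒥φ, 𝒥ψ⟩`. -/
theorem inner_twistedTranslate (k l k' l' : Fin n → ℤ) (φ ψ : L2R2 n) :
    inner ℂ (twistedTranslate k l φ) (twistedTranslate k' l' ψ) =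
      ∫ p, star (zakPhase k l p) * zakPhase k' l' p * inner ℂ (jMap φ p) (jMap ψ p)
        ∂((torusMeasure n).prod (torusMeasure n)) := by
  rw [← inner_weylZak, weylZak_twistedTranslate, weylZak_twistedTranslate, L2.inner_def,
    integral_prod _ (L2.integrable_inner _ _)]
  refine integral_congr_ae ?_
  filter_upwards [ae_inner_jMap φ ψ,
    Measure.ae_ae_of_ae_prod (coeFn_zakModulation k l (weylZak φ)),
    Measure.ae_ae_of_ae_prod (coeFn_zakModulation k' l' (weylZak ψ))] with p h1 h2 h3
  rw [h1, ← integral_const_mul]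
  refine integral_congr_ae ?_
  filter_upwards [h2, h3] with η h4 h5
  rw [h4, h5]
  simp only [RCLike.inner_apply, map_mul, Complex.star_def]
  ring

theorem principalSpace_isOrtho_iff (φ ψ : L2R2 n) :
    principalSpace φ ⟂ principalSpace ψ ↔ ∀ k l k' l' : Fin n → ℤ,
      inner ℂ (twistedTranslate k l φ) (twistedTranslate k' l' ψ) = 0 := by
  rw [principalSpace, principalSpace, Submodule.IsOrtho,
    Submodule.orthogonal_closure]
  -- Orthogonal complements are closed, so taking closures does not affect orthogonality.
  have h : ∀ U V : Submodule ℂ (L2R2 n), U.topologicalClosure ≤ Vᗮ ↔ U ⟂ V := fun U V =>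
    ⟨U.le_topologicalClosure.trans,
      fun h => U.topologicalClosure_minimal h V.isClosed_orthogonal⟩
  rw [h, Submodule.isOrtho_span]
  simp only [Set.forall_mem_range, Prod.forall]

/-- The signs in `-k`, `-l` offset the conjugation, so every character of `𝕋ⁿ × 𝕋ⁿ` arises, up to a
nonzero constant. -/
theorem star_zakPhase_mul_zakPhase_zero (k l : Fin n → ℤ) (p : RSpace n × RSpace n) :
    star (zakPhase (-k) (-l) p) * zakPhase 0 0 p =
      Complex.exp (-(Real.pi * Complex.I * ((inner ℝ (intVec k) (intVec l) : ℝ) : ℂ))) *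
        Complex.exp (2 * Real.pi * Complex.I *
          ((inner ℝ (intVec k) p.1 + inner ℝ (intVec l) p.2 : ℝ) : ℂ)) := by
  rw [zakPhase, zakPhase, Complex.star_def, ← Complex.exp_conj, ← Complex.exp_add,
    ← Complex.exp_add]
  congr 1
  have h0 : intVec (0 : Fin n → ℤ) = 0 := by ext i; simp [intVec]
  have hn : ∀ m : Fin n → ℤ, intVec (-m) = -intVec m := fun m => by ext i; simp [intVec]
  simp only [h0, hn, inner_zero_left, inner_neg_left, inner_neg_right, map_mul, Complex.conj_I,
    Complex.conj_ofReal]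
  push_cast
  ring

end

theorem mainTheorem9 (n : ℕ) (φ₁ φ₂ : L2R2 n) :
    principalSpace φ₁ ⟂ principalSpace φ₂ ↔
      ∀ᵐ p : RSpace n × RSpace n ∂((torusMeasure n).prod (torusMeasure n)),
        inner ℂ (jMap φ₁ p) (jMap φ₂ p) = 0 := by
  rw [principalSpace_isOrtho_iff]
  constructor
  · intro h
    refine ae_eq_zero_of_forall_integral_exp (integrable_inner_jMap φ₁ φ₂) fun k l => ?_
    have h1 := h (-k) (-l) 0 0
    simp only [inner_twistedTranslate, star_zakPhase_mul_zakPhase_zero, mul_assoc,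
      integral_const_mul] at h1
    simpa only [mul_assoc] using (mul_eq_zero.1 h1).resolve_left (Complex.exp_ne_zero _)
  · intro h k l k' l'
    rw [inner_twistedTranslate]
    refine integral_eq_zero_of_ae ?_
    filter_upwards [h] with p hp
    rw [hp, mul_zero, Pi.zero_apply]
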